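/- **Setting.** Let $(\Omega,\mathcal F)$ be a measurable space, $\mathbb P_\star$ a measure on it, $X\subseteq\mathbb R^n$ compact, $\Theta\subseteq\mathbb R^d$, and $\{\xi_t\}_{t\ge 1}$ a stochastic process on $(\Omega,\mathcal F)$ with values in $\mathbb R^m$; let $\mathcal F_T=\sigma(\xi_1,\dots,\xi_T)$. *Ambiguity set.* $\{\mathbb P_\theta:\theta\in\Theta\}$ is called a finitely parametrized ambiguity set if $\Theta$ is convex and relatively open (open in its affine hull), each $\mathbb P_\theta$ is a probability measure on $(\Omega,\mathcal F)$, and $\mathbb P_\star\in\{\mathbb P_\theta:\theta\in\Theta\}$. *Model-based predictor.* $c:X\times\Theta\to\mathbb R$ is uniformly continuous and bounded; its unique continuous extension to $X\times\operatorname{cl}\Theta$ is also denoted by $c$. *Statistic.* $\widehat S=\{\widehat S_T\}_{T\ge1}$ is a process in $\mathbb R^d$ adapted to $\{\mathcal F_T\}_{T\ge 1}$; its state space $\mathbb S$ is the smallest closed set with $\mathbb P_\theta[\widehat S_T\in\mathbb S]=1$ for all $\theta\in\Theta$, $T\ge 1$; and there is a local homeomorphism $S_\infty:\Theta\to\mathbb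 S$ such that $\widehat S_T\to S_\infty(\theta)$ in $\mathbb P_\theta$-probability for every $\theta\in\Theta$. Let $\mathbb S_\infty=S_\infty(\Theta)$. *Rate functions.* A rate function is a map $I:\mathbb S\times\operatorname{cl}\Theta\to[0,\infty]$ that is lower semicontinuous in $s$. The statistic $\widehat S$ satisfies a large deviation principle (LDP) under $\{\mathbb P_\theta\}$ with rate function $I$ if for all $\theta\in\Theta$ and Borel sets $\mathcal D\subseteq\mathbb S$ $$-\inf_{s\in\operatorname{int}\mathcal D}I(s,\theta)\le\liminf_{T\to\infty}\tfrac1T\log\mathbb P_\theta[\widehat S_T\in\mathcal D]\le\limsup_{T\to\infty}\tfrac1T\log\mathbb P_\theta[\widehat S_T\in\mathcal D]\le-\inf_{s\in\operatorname{cl}\mathcal D}I(s,\theta),$$ with interior and closure relative to $\mathbb S$. A rate function $I$ is regular if (i) $\operatorname{cl}\{\theta\in\Theta:I(s,\theta)<r\}=\{\theta\in\operatorname{cl}\Theta:I(s,\theta)\le r\}$ for all $s\in\mathbb S_\infty$, $r>0$; (ii) $I$ is continuous on $\mathbb S\times\Theta$; (iii) $\{(s,\theta)\in\mathbb S\times\operatorname{cl}\Theta:I(s,\theta)\le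 r\}$ is compact for every $r\ge0$. *Distributionally robust predictor and prescriptor.* For $r\ge0$, the distributionally robust predictor induced by $c$, $I$ and $r$ is $\tilde c^\star(x,s)=\max\{c(x,\theta):\theta\in\operatorname{cl}\Theta,\ I(s,\theta)\le r\}$ if some $\theta\in\operatorname{cl}\Theta$ has $I(s,\theta)\le r$, and $\tilde c^\star(x,s)=\sup_{\theta\in\operatorname{cl}\Theta}c(x,\theta)$ otherwise. A corresponding distributionally robust prescriptor is any $\tilde x^\star:\mathbb S\to X$ that is quasi-continuous on $\mathbb S_\infty$ and satisfies $\tilde x^\star(s)\in\arg\min_{x\in X}\tilde c^\star(x,s)$ for all $s\in\mathbb S$. Here $f$ is quasi-continuous at $a$ if for all neighbourhoods $U$ of $a$ and $V$ of $f(a)$ there is a non-empty open $W\subseteq U$ with $f(W)\subseteq V$. **Proposition (Invariance under coordinate transformations of $\operatorname{cl}\Theta$).** Assume that $\{\mathbb P_\theta:\theta\in\Theta\}$ is a finitely parametrized ambiguity set, that $c$ is uniformly continuous and bounded on $X\times\Theta$, and that the statistic $\widehat S$ satisfies an LDP with a regular rate function $I$. Let $\varphi:\operatorname{cl}\Theta\to\operatorname{cl}\Theta$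 be a homeomorphism. Then: 1. $\varphi$ restricts to a homeomorphism of $\Theta$ onto $\Theta$, and $\mathcal P_\varphi=\{\mathbb P_{\varphi(\theta)}:\theta\in\Theta\}$ is a finitely parametrized ambiguity set that coincides, as a set of measures, with $\{\mathbb P_\theta:\theta\in\Theta\}$. 2. $c_\varphi(x,\theta)=c(x,\varphi^{-1}(\theta))$ is uniformly continuous and bounded on $X\times\Theta$, and its continuous extension to $X\times\operatorname{cl}\Theta$ is given by the same formula. 3. $I_\varphi(s,\theta)=I(s,\varphi^{-1}(\theta))$ is a regular rate function. Moreover, $\{\mathbb P_{\varphi^{-1}(\theta)}:\theta\in\Theta\}$ is a finitely parametrized ambiguity set under which $\widehat S$ is a statistic with the same state space $\mathbb S$, limit $S_\infty\circ\varphi^{-1}$ and the same set $\mathbb S_\infty$, and under which $\widehat S$ satisfies an LDP with rate function $I_\varphi$. 4. For every $r\ge0$, the maximum and the supremum defining $\tilde c^\star$ are attained and finite, respectively; the distributionally robust predictor induced by $c_\varphi$, $I_\varphi$ and $r$ equals the one induced by $c$, $I$ and $r$; and a map $\tilde x^\star:\mathbb S\to X$ is a distributionally robust prescriptor for $c_\varphi$,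 $I_\varphi$ and $r$ if and only if it is one for $c$, $I$ and $r$. -/

import Mathlib

open MeasureTheory Filter Topology Set
open scoped NNReal ENNReal

/-- The Euclidean space `ℝᵏ`. -/
abbrev E (k : ℕ) : Type := EuclideanSpace ℝ (Fin k)

namespace DataDriven

/-- The inclusion of the model space `Θ` into its closure. -/
def toClosure {d : ℕ} {Θ : Set (E d)} (θ : Θ) : closure Θ :=
  Set.inclusion subset_closure θ

/-- `{P θ : θ ∈ Θ}` is a finitely parametrized ambiguity set for `Pstar`: the model space `Θ` is a
convex subset of `ℝᵈ` that is relatively open (it equals its interior relative to its affine hull),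
every `P θ` is a probability measure, and `Pstar` is one of the measures `P θ`. -/
structure IsFinitelyParametrized {d : ℕ} {Ω : Type*} [MeasurableSpace Ω] {Θ : Set (E d)}
    (Pstar : Measure Ω) (P : Θ → Measure Ω) : Prop where
  convex : Convex ℝ Θ
  relOpen : intrinsicInterior ℝ Θ = Θ
  isProbabilityMeasure : ∀ θ, IsProbabilityMeasure (P θ)
  mem : Pstar ∈ range P

/-- The model-based predictor is uniformly continuous and bounded on `X × Θ`. -/
def IsUniformlyContinuousBounded {n d : ℕ} {X : Set (E n)} {Θ : Set (E d)}
    (c : X → Θ → ℝ) : Prop :=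
  UniformContinuous (fun p : X × Θ => c p.1 p.2) ∧ ∃ C : ℝ, ∀ x θ, |c x θ| ≤ C

theorem isDenseInducing_prod {n d : ℕ} (X : Set (E n)) (Θ : Set (E d)) :
    IsDenseInducing (Prod.map id toClosure : X × Θ → X × closure Θ) :=
  IsDenseInducing.prodMap ⟨IsInducing.id, denseRange_id⟩
    ⟨(Topology.IsEmbedding.inclusion subset_closure).isInducing,
      (denseRange_inclusion_iff subset_closure).2 subset_rfl⟩

/-- The extension of the model-based predictor from `X × Θ` to `X × cl Θ` by continuity. -/
noncomputable def predictorExt {n d : ℕ} {X : Set (E n)} {Θ : Set (E d)}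
    (c : X → Θ → ℝ) (x : X) (θ : closure Θ) : ℝ :=
  (isDenseInducing_prod X Θ).extend (fun p : X × Θ => c p.1 p.2) (x, θ)

/-- The σ-algebra generated by `ξ₁, …, ξ_T`. -/
abbrev history {m : ℕ} {Ω : Type*} (ξ : ℕ+ → Ω → E m) (T : ℕ+) : MeasurableSpace Ω :=
  ⨆ t : {t : ℕ+ // t ≤ T}, MeasurableSpace.comap (ξ t) inferInstance

/-- `S` is a statistic with state space `SS` and asymptotic realizations `Sinf θ`. The state space
is the smallest closed set that contains every `S T` almost surely under every model. -/
structure IsStatistic {m d : ℕ} {Ω : Type*} [MeasurableSpace Ω] {Θ : Set (E d)}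
    (ξ : ℕ+ → Ω → E m) (P : Θ → Measure Ω) (S : ℕ+ → Ω → E d)
    (SS : Set (E d)) (Sinf : Θ → SS) : Prop where
  adapted : ∀ T, Measurable[history ξ T] (S T)
  stateSpace : IsLeast {C : Set (E d) | IsClosed C ∧ ∀ θ T, ∀ᵐ ω ∂(P θ), S T ω ∈ C} SS
  localHomeomorph : IsLocalHomeomorph Sinf
  tendsto : ∀ θ, TendstoInMeasure (P θ) S atTop (fun _ => (Sinf θ : E d))

/-- `I : SS × cl Θ → [0, ∞]` is a rate function: it is lower semicontinuous in its first
argument. -/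
def IsRateFunction {d : ℕ} {Θ SS : Set (E d)} (I : SS → closure Θ → ℝ≥0∞) : Prop :=
  ∀ θ, LowerSemicontinuous (fun s => I s θ)

/-- The statistic `S` satisfies a large deviation principle with rate function `I`. Interiors and
closures are relative to the state space `SS`, and `log 0 = -∞`. -/
def SatisfiesLDP {d : ℕ} {Ω : Type*} [MeasurableSpace Ω] {Θ SS : Set (E d)}
    (P : Θ → Measure Ω) (S : ℕ+ → Ω → E d) (I : SS → closure Θ → ℝ≥0∞) : Prop :=
  IsRateFunction I ∧
  ∀ θ : Θ, ∀ D : Set SS, MeasurableSet D →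
    -((⨅ s ∈ interior D, I s (toClosure θ) : ℝ≥0∞) : EReal) ≤
      liminf (fun T : ℕ+ => (((1 : ℝ) / (T : ℕ) : ℝ) : EReal) *
        ENNReal.log (P θ (S T ⁻¹' (Subtype.val '' D)))) atTop ∧
    limsup (fun T : ℕ+ => (((1 : ℝ) / (T : ℕ) : ℝ) : EReal) *
        ENNReal.log (P θ (S T ⁻¹' (Subtype.val '' D)))) atTop ≤
      -((⨅ s ∈ closure D, I s (toClosure θ) : ℝ≥0∞) : EReal)

/-- The rate function `I` is regular, where `A` is the set of asymptotic realizations. -/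
structure IsRegular {d : ℕ} {Θ SS : Set (E d)} (A : Set SS)
    (I : SS → closure Θ → ℝ≥0∞) : Prop where
  rateFunction : IsRateFunction I
  radialMonotonicity : ∀ s ∈ A, ∀ r : ℝ≥0, 0 < r →
    closure {θ : closure Θ | (θ : E d) ∈ Θ ∧ I s θ < r} = {θ : closure Θ | I s θ ≤ r}
  continuity : ContinuousOn (fun p : SS × closure Θ => I p.1 p.2) {p | (p.2 : E d) ∈ Θ}
  levelCompactness : ∀ r : ℝ≥0, IsCompact {p : SS × closure Θ | I p.1 p.2 ≤ r}

open Classical in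
/-- The distributionally robust predictor induced by `I` and `r`. -/
noncomputable def droPredictor {n d : ℕ} {X : Set (E n)} {Θ SS : Set (E d)}
    (c : X → Θ → ℝ) (I : SS → closure Θ → ℝ≥0∞) (r : ℝ≥0) (x : X) (s : SS) : ℝ :=
  if ∃ θ, I s θ ≤ r then sSup (predictorExt c x '' {θ | I s θ ≤ r})
  else sSup (range (predictorExt c x))

/-- `f` is quasi-continuous at `a`. -/
def QuasiContinuousAt {α β : Type*} [TopologicalSpace α] [TopologicalSpace β]
    (f : α → β) (a : α) : Prop :=
  ∀ U ∈ 𝓝 a, ∀ V ∈ 𝓝 (f a), ∃ W : Set α, IsOpen W ∧ W.Nonempty ∧ W ⊆ U ∧ ∀ a' ∈ W, f a' ∈ V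

/-- `f` is quasi-continuous on `A`. -/
def QuasiContinuousOn {α β : Type*} [TopologicalSpace α] [TopologicalSpace β]
    (f : α → β) (A : Set α) : Prop :=
  ∀ a : A, QuasiContinuousAt (fun a' : A => f a') a

/-- `xt` is a distributionally robust prescriptor for the distributionally robust predictor
induced by `I` and `r`, where `A` is the set of asymptotic realizations. -/
def IsDROPrescriptor {n d : ℕ} {X : Set (E n)} {Θ SS : Set (E d)} (A : Set SS)
    (c : X → Θ → ℝ) (I : SS → closure Θ → ℝ≥0∞) (r : ℝ≥0) (xt : SS → X) : Prop :=
  QuasiContinuousOn xt A ∧ ∀ s x, droPredictor c I r (xt s) s ≤ droPredictor c I r x s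

end DataDriven

/-!
Once `φ` is known to preserve `Θ`, composition with `φ⁻¹` is a relabelling that commutes with every
construction. That `φ` does so is topological: a homeomorphism between convex sets in finite
dimensions preserves relative interiors, and a relatively open convex set is the relative interior
of its closure. If `x` is interior to the source, push `φ x` a little towards an interior point of
the target and pull back with `φ⁻¹`. This is a small perturbation of the identity, so `x` is still
in its image, hence `φ x` is the push of some point and is therefore interior. That small
perturbations of the identity keep covering `x` is a form of Brouwer's theorem. It comes from the
absence of a `C¹` retraction `id + u` of the unit ball onto the sphere: the integral of
`det (1 + t • u')` over the ball is a polynomial in `t` that equals the volume of the ball for small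
`t`, where `id + t • u` permutes the ball, but vanishes at `t = 1`.

The rate function vanishes at `(S_∞ θ, θ)`, because the statistic concentrates there. Hence the
projection to `cl Θ` of the compact sublevel set of level `0` contains `Θ`, so `cl Θ` is compact and
`φ` is uniformly continuous.
-/

section Determinant

theorem exists_polynomial_eval_eq_det_one_add_smul {R M : Type*} [CommRing R] [Nontrivial R]
    [AddCommGroup M] [Module R M] [Module.Free R M] [Module.Finite R M] (A : M →ₗ[R] M) :
    ∃ p : Polynomial R, p.natDegree ≤ Module.finrank R M ∧
      ∀ t, p.eval t = LinearMap.det (1 + t • A) := by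
  classical
  let b := Module.finBasis R M
  refine ⟨_, Fintype.card_fin (Module.finrank R M) ▸
    Polynomial.natDegree_det_X_add_C_le (LinearMap.toMatrix b b A) 1, fun t => ?_⟩
  rw [← LinearMap.det_toMatrix b, map_add, map_smul, LinearMap.toMatrix_one,
    ← Polynomial.coe_evalRingHom, RingHom.map_det, RingHom.mapMatrix_apply]
  congr 1
  ext i j
  simp [Matrix.one_apply, apply_ite, add_comm, mul_comm t]

theorem det_one_add_eq_sum_lagrange {K M : Type*} [Field K] [AddCommGroup M] [Module K M]
    [FiniteDimensional K M] [DecidableEq K] (A : M →ₗ[K] M) {s : Finset K}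
    (hs : Module.finrank K M < s.card) :
    LinearMap.det (1 + A) =
      ∑ t ∈ s, (Lagrange.basis s id t).eval 1 * LinearMap.det (1 + t • A) := by
  obtain ⟨p, hdeg, hp⟩ := exists_polynomial_eval_eq_det_one_add_smul A
  have hlt : p.degree < s.card :=
    Polynomial.degree_le_natDegree.trans_lt (by exact_mod_cast hdeg.trans_lt hs)
  calc LinearMap.det (1 + A) = p.eval 1 := by rw [hp, one_smul]
    _ = (Lagrange.interpolate s id fun t => p.eval t).eval 1 :=
      congrArg _ (Lagrange.eq_interpolate (injOn_id _) hlt)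
    _ = _ := by
      simp only [Lagrange.interpolate_apply, Polynomial.eval_finsetSum, Polynomial.eval_mul,
        Polynomial.eval_C, hp, mul_comm]

end Determinant

section Perturbation

variable {V : Type*} [NormedAddCommGroup V] [NormedSpace ℝ V] {s : Set V}

theorem exists_mem_frontier_dist_le {x y : V} (hx : x ∈ s) (hy : y ∉ s) :
    ∃ z ∈ frontier s, dist x z ≤ dist x y := by
  have hcover : segment ℝ x y ⊆ closure s ∪ closure sᶜ := fun z _ =>
    (em (z ∈ s)).imp (fun h => subset_closure h) fun h => subset_closure h
  obtain ⟨z, hz, hzs⟩ := isPreconnected_closed_iff.1 (convex_segment x y).isPreconnected _ _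
    isClosed_closure isClosed_closure hcover ⟨x, left_mem_segment ℝ x y, subset_closure hx⟩
    ⟨y, right_mem_segment ℝ x y, subset_closure hy⟩
  refine ⟨z, by rwa [frontier_eq_closure_inter_closure], ?_⟩
  linarith [dist_add_dist_of_mem_segment hz, dist_nonneg (x := z) (y := y)]

theorem lipschitzWith_indicator_of_eqOn_frontier {F : Type*} [NormedAddCommGroup F] {K : ℝ≥0}
    {u : V → F} (hs : IsClosed s) (hu : LipschitzOnWith K u s)
    (h0 : EqOn u 0 (frontier s)) : LipschitzWith K (s.indicator u) := by
  have dist_zero_le : ∀ x ∈ s, ∀ y ∉ s, dist (u x) 0 ≤ K * dist x y := by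
    intro x hx y hy
    obtain ⟨z, hz, hxz⟩ := exists_mem_frontier_dist_le hx hy
    calc dist (u x) 0 = dist (u x) (u z) := by rw [h0 hz, Pi.zero_apply]
      _ ≤ K * dist x z := hu.dist_le_mul x hx z (hs.frontier_subset hz)
      _ ≤ K * dist x y := by gcongr
  refine LipschitzWith.of_dist_le_mul fun x y => ?_
  by_cases hx : x ∈ s <;> by_cases hy : y ∈ s
  · simpa only [indicator_of_mem hx, indicator_of_mem hy] using hu.dist_le_mul x hx y hy
  · simpa only [indicator_of_mem hx, indicator_of_notMem hy] using dist_zero_le x hx y hy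
  · simpa only [indicator_of_notMem hx, indicator_of_mem hy, dist_comm] using dist_zero_le y hy x hx
  · rw [indicator_of_notMem hx, indicator_of_notMem hy, dist_self]
    positivity

variable [CompleteSpace V] {K : ℝ≥0} {u : V → V}

theorem bijective_id_add_of_lipschitzWith (hu : LipschitzWith K u) (hK : K < 1) :
    Function.Bijective fun x => x + u x := by
  have happrox : ApproximatesLinearOn (fun x => x + u x)
      (ContinuousLinearEquiv.refl ℝ V : V →L[ℝ] V) univ K := by
    intro x _ y _
    have h := hu.norm_sub_le x y
    rw [show x + u x - (y + u y) - (ContinuousLinearEquiv.refl ℝ V : V →L[ℝ] V) (x - y) =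
      u x - u y by simp; abel]
    exact h
  refine (happrox.toHomeomorph _ ?_).bijective
  rcases subsingleton_or_nontrivial V with h | h
  · exact Or.inl h
  · right
    rwa [show ‖((ContinuousLinearEquiv.refl ℝ V).symm : V →L[ℝ] V)‖₊ = 1 from
      ContinuousLinearMap.nnnorm_id, inv_one]

theorem bijOn_id_add_of_eqOn_frontier (hs : IsClosed s) (hu : LipschitzOnWith K u s)
    (h0 : EqOn u 0 (frontier s)) (hK : K < 1) : BijOn (fun x => x + u x) s s := by
  have hbij := bijective_id_add_of_lipschitzWith
    (lipschitzWith_indicator_of_eqOn_frontier hs hu h0) hK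
  have hcompl : BijOn (fun x => x + s.indicator u x) sᶜ sᶜ :=
    (bijOn_id sᶜ).congr fun x hx => by simp [indicator_of_notMem hx]
  rw [← compl_compl s]
  refine (hcompl.compl hbij).congr fun x hx => ?_
  rw [compl_compl] at hx
  simp only [indicator_of_mem hx]

end Perturbation

section Volume

variable {V : Type*} [NormedAddCommGroup V] [NormedSpace ℝ V] [FiniteDimensional ℝ V]
  {s : Set V} {u : V → V} [MeasurableSpace V] [BorelSpace V] (μ : Measure V) [μ.IsAddHaarMeasure]

theorem eventually_setIntegral_det_one_add_smul_fderiv (hs : IsCompact s) (hconv : Convex ℝ s)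
    (hu : ContDiff ℝ 1 u) (h0 : EqOn u 0 (frontier s)) :
    ∀ᶠ t : ℝ in 𝓝 0, ∫ x in s, (1 + t • fderiv ℝ u x).det ∂μ = μ.real s := by
  have hcont : Continuous fun z : ℝ × V => (1 + z.1 • fderiv ℝ u z.2).det :=
    ContinuousLinearMap.continuous_det.comp <| by
      have := hu.continuous_fderiv one_ne_zero
      fun_prop
  have hpos : ∀ᶠ t : ℝ in 𝓝 0, ∀ x ∈ s, 0 < (1 + t • fderiv ℝ u x).det :=
    hs.eventually_forall_of_forall_eventually fun x _ =>
      hcont.continuousAt.eventually (lt_mem_nhds (by simp [ContinuousLinearMap.det]))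
  obtain ⟨K, hK⟩ := hu.contDiffOn.exists_lipschitzOnWith one_ne_zero hconv hs
  have hsmall : ∀ᶠ t : ℝ in 𝓝 0, ‖t‖₊ * K < 1 :=
    (continuous_nnnorm.mul continuous_const).continuousAt.eventually (gt_mem_nhds (by simp))
  filter_upwards [hpos, hsmall] with t hpos hK1
  have hLip : LipschitzOnWith (‖t‖₊ * K) (fun x => t • u x) s :=
    (lipschitzWith_smul t).comp_lipschitzOnWith hK
  have hbij := bijOn_id_add_of_eqOn_frontier hs.isClosed hLip (fun x hx => by simp [h0 hx]) hK1
  have hderiv : ∀ x, HasFDerivAt (fun x => x + t • u x) (1 + t • fderiv ℝ u x) x := fun x =>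
    (hasFDerivAt_id x).add ((hu.differentiable one_ne_zero x).hasFDerivAt.const_smul t)
  calc ∫ x in s, (1 + t • fderiv ℝ u x).det ∂μ
      = ∫ x in s, |(1 + t • fderiv ℝ u x).det| • (1 : ℝ) ∂μ :=
        setIntegral_congr_fun hs.measurableSet fun x hx => by simp [abs_of_pos (hpos x hx)]
    _ = ∫ _ in (fun x => x + t • u x) '' s, (1 : ℝ) ∂μ :=
        (integral_image_eq_integral_abs_det_fderiv_smul μ hs.measurableSet
          (fun x _ => (hderiv x).hasFDerivWithinAt) hbij.injOn fun _ => 1).symm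
    _ = μ.real s := by rw [hbij.image_eq]; simp

theorem setIntegral_det_one_add_fderiv (hs : IsCompact s) (hconv : Convex ℝ s)
    (hu : ContDiff ℝ 1 u) (h0 : EqOn u 0 (frontier s)) :
    ∫ x in s, (1 + fderiv ℝ u x).det ∂μ = μ.real s := by
  classical
  obtain ⟨nodes, hnodes, hcard⟩ := (infinite_of_mem_nhds (0 : ℝ)
    (eventually_setIntegral_det_one_add_smul_fderiv μ hs hconv hu h0)).exists_subset_card_eq
      (Module.finrank ℝ V + 1)
  have hne : nodes.Nonempty := Finset.card_pos.1 (by omega)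
  have hint : ∀ t ∈ nodes, IntegrableOn (fun x => (Lagrange.basis nodes id t).eval 1 *
      (1 + t • fderiv ℝ u x).det) s μ := fun t _ =>
    have hcont : Continuous fun x => (1 + t • fderiv ℝ u x).det :=
      ContinuousLinearMap.continuous_det.comp <| by
        have := hu.continuous_fderiv one_ne_zero
        fun_prop
    Integrable.const_mul (hcont.continuousOn.integrableOn_compact hs) _
  calc ∫ x in s, (1 + fderiv ℝ u x).det ∂μ
      = ∫ x in s, ∑ t ∈ nodes, (Lagrange.basis nodes id t).eval 1 *
          (1 + t • fderiv ℝ u x).det ∂μ := by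
        congr with x
        exact det_one_add_eq_sum_lagrange (fderiv ℝ u x : V →ₗ[ℝ] V) (by omega)
    _ = ∑ t ∈ nodes, (Lagrange.basis nodes id t).eval 1 *
          ∫ x in s, (1 + t • fderiv ℝ u x).det ∂μ := by
        rw [integral_finsetSum _ hint]
        simp only [integral_const_mul]
    _ = ∑ t ∈ nodes, (Lagrange.basis nodes id t).eval 1 * μ.real s :=
        Finset.sum_congr rfl fun t ht => by rw [hnodes ht]
    _ = μ.real s := by
        rw [← Finset.sum_mul, ← Polynomial.eval_finsetSum, Lagrange.sum_basis (injOn_id _) hne,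
          Polynomial.eval_one, one_mul]

end Volume

section Brouwer

variable {V : Type*} [NormedAddCommGroup V] [InnerProductSpace ℝ V]

theorem inner_fderiv_eq_zero_of_norm_eq_one {r : V → V} (hnorm : ∀ y, ‖r y‖ = 1) {x : V}
    (hr : DifferentiableAt ℝ r x) (w : V) : inner ℝ (r x) (fderiv ℝ r x w) = 0 := by
  have hconst : HasFDerivAt (fun y => ‖r y‖ ^ 2) (0 : V →L[ℝ] ℝ) x := by
    simpa only [hnorm] using hasFDerivAt_const _ _
  simpa using DFunLike.congr_fun (hr.hasFDerivAt.norm_sq.unique hconst) w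

variable [FiniteDimensional ℝ V]

theorem det_fderiv_eq_zero_of_norm_eq_one {r : V → V} (hnorm : ∀ y, ‖r y‖ = 1) {x : V}
    (hr : DifferentiableAt ℝ r x) : (fderiv ℝ r x).det = 0 := by
  by_contra hdet
  obtain ⟨w, hw⟩ := ((fderiv ℝ r x).toContinuousLinearEquivOfDetNeZero hdet).surjective (r x)
  have h := inner_fderiv_eq_zero_of_norm_eq_one hnorm hr w
  rw [show fderiv ℝ r x w = r x from hw, real_inner_self_eq_norm_sq, hnorm] at h
  norm_num at h

theorem not_exists_contDiff_retraction_sphere : ¬ ∃ r : V → V,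
    ContDiff ℝ 1 r ∧ (∀ x, ‖r x‖ = 1) ∧ ∀ x, ‖x‖ = 1 → r x = x := by
  rintro ⟨r, hr, hnorm, hid⟩
  borelize V
  have hdiff : Differentiable ℝ r := hr.differentiable one_ne_zero
  have hfrontier : EqOn (r - id) 0 (frontier (Metric.closedBall (0 : V) 1)) := fun x hx => by
    simp [hid x (by simpa using Metric.frontier_closedBall_subset_sphere hx)]
  have hvol := setIntegral_det_one_add_fderiv (u := r - id) volume (isCompact_closedBall (0 : V) 1)
    (convex_closedBall 0 1) (hr.sub contDiff_id) hfrontier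
  have hdet : ∀ x, (1 + fderiv ℝ (r - id) x).det = 0 := fun x => by
    rw [fderiv_sub (hdiff x) differentiableAt_id, fderiv_id, ContinuousLinearMap.one_def,
      add_sub_cancel, det_fderiv_eq_zero_of_norm_eq_one hnorm (hdiff x)]
  simp only [hdet, integral_zero] at hvol
  exact (ENNReal.toReal_pos (Metric.measure_closedBall_pos volume (0 : V) one_pos).ne'
    measure_closedBall_lt_top.ne).ne hvol

theorem exists_eq_zero_of_eq_self_of_le_norm {h : V → V} (hh : Continuous h) {R : ℝ} (hR : 0 < R)
    (hid : ∀ x, R ≤ ‖x‖ → h x = x) : ∃ x, h x = 0 := by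
  by_contra! hne
  obtain ⟨p, hp, hpdist, hpsupp⟩ := (hh.sub continuous_id).exists_contDiff_approx 1
    hh.norm fun x => norm_pos_iff.2 (hne x)
  have hq0 : ∀ x, x + p x ≠ 0 := fun x hx => by
    have h1 := hpdist x
    rw [eq_neg_of_add_eq_zero_right hx, dist_eq_norm, ← norm_neg] at h1
    simp at h1
  have hqid : ∀ x, R ≤ ‖x‖ → x + p x = x := fun x hx => by
    rw [add_eq_left]
    exact Function.notMem_support.1 fun h1 => hpsupp h1 (by simp [hid x hx])
  have hq : ContDiff ℝ 1 fun x : V => R • x + p (R • x) := by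
    have hp' : ContDiff ℝ 1 p := hp
    fun_prop
  refine not_exists_contDiff_retraction_sphere
    ⟨fun x : V => ‖R • x + p (R • x)‖⁻¹ • (R • x + p (R • x)), ?_, fun x => ?_, fun x hx => ?_⟩
  · exact ((hq.norm ℝ fun x => hq0 _).inv fun x => norm_ne_zero_iff.2 (hq0 _)).smul hq
  · exact norm_smul_inv_norm (𝕜 := ℝ) (hq0 _)
  · have hnorm : ‖R • x‖ = R := by rw [norm_smul, hx, mul_one, Real.norm_of_nonneg hR.le]
    simp only [hqid _ hnorm.ge, hnorm, inv_smul_smul₀ hR.ne']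

theorem exists_isFixedPt_of_norm_le {g : V → V} (hg : Continuous g) {δ : ℝ} (hδ : 0 < δ)
    (hle : ∀ x, δ ≤ ‖x‖ → ‖g x‖ ≤ δ) : ∃ x, ‖x‖ ≤ δ ∧ Function.IsFixedPt g x := by
  -- The cutoff makes `x - χ x • g x` equal to `x` far from the origin, without creating new zeros.
  let χ : V → ℝ := fun x => max 0 (min 1 (2 - ‖x‖ / δ))
  have hχ0 : ∀ x, 0 ≤ χ x := fun x => le_max_left _ _
  have hχ1 : ∀ x, χ x ≤ 1 := fun x => max_le zero_le_one (min_le_left _ _)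
  obtain ⟨x, hx⟩ := exists_eq_zero_of_eq_self_of_le_norm
    (h := fun x => x - χ x • g x) (by fun_prop) (R := 2 * δ) (by positivity) fun x hx => by
      have : 2 ≤ ‖x‖ / δ := (le_div_iff₀ hδ).2 hx
      simp [χ, this]
  rw [sub_eq_zero] at hx
  have hxδ : ‖x‖ ≤ δ := by
    by_contra! hlt
    refine hlt.not_ge ?_
    calc ‖x‖ = χ x * ‖g x‖ := by
          conv_lhs => rw [hx, norm_smul, Real.norm_of_nonneg (hχ0 x)]
      _ ≤ 1 * δ := by gcongr; exacts [hχ1 x, hle x hlt.le]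
      _ = δ := one_mul δ
  have hχ : χ x = 1 := by
    have : ‖x‖ / δ ≤ 1 := (div_le_one hδ).2 hxδ
    rw [show χ x = max 0 (min 1 (2 - ‖x‖ / δ)) from rfl, min_eq_left (by linarith),
      max_eq_right zero_le_one]
  rw [hχ, one_smul] at hx
  exact ⟨x, hxδ, hx.symm⟩

theorem exists_eq_of_dist_le_on_sphere {p : V} {δ : ℝ} (hδ : 0 < δ)
    {f : Metric.closedBall p δ → V} (hf : Continuous f)
    (hclose : ∀ x : Metric.closedBall p δ, dist (x : V) p = δ → dist (x : V) (f x) ≤ δ) :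
    p ∈ range f := by
  have hmax : ∀ x : V, 0 < max δ ‖x‖ := fun x => lt_max_of_lt_left hδ
  have hmem : ∀ x, p + (δ / max δ ‖x‖) • x ∈ Metric.closedBall p δ := fun x => by
    rw [Metric.mem_closedBall, dist_self_add_left, norm_smul, Real.norm_of_nonneg
      (div_pos hδ (hmax x)).le, div_mul_eq_mul_div, div_le_iff₀ (hmax x)]
    exact mul_le_mul_of_nonneg_left (le_max_right _ _) hδ.le
  let ρ : V → Metric.closedBall p δ := fun x => ⟨p + (δ / max δ ‖x‖) • x, hmem x⟩
  have hρ : Continuous ρ := by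
    have := fun x => (hmax x).ne'
    exact Continuous.subtype_mk (by fun_prop (disch := assumption)) _
  obtain ⟨x, hx, hfix⟩ := exists_isFixedPt_of_norm_le (g := fun x => ρ x - f (ρ x))
    (by fun_prop) hδ fun x hx => by
      have hx0 : x ≠ 0 := norm_pos_iff.1 (hδ.trans_le hx)
      rw [← dist_eq_norm]
      exact hclose _ (by simp [ρ, hx, norm_smul, abs_of_pos hδ, hx0])
  have hρx : (ρ x : V) = p + x := by simp [ρ, hx, hδ.ne']
  refine ⟨ρ x, ?_⟩
  have : (p + x) - f (ρ x) = x := hρx ▸ hfix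
  rwa [add_sub_right_comm, add_eq_right, sub_eq_zero, eq_comm] at this

theorem eventually_mem_range_of_mem_interior {Y : Type*} [TopologicalSpace Y] {s : Set V}
    {F : Y → s → V} (hF : Continuous fun z : Y × s => F z.1 z.2) {y₀ : Y}
    (hy₀ : ∀ a, F y₀ a = a) {x : V} (hx : x ∈ interior s) : ∀ᶠ y in 𝓝 y₀, x ∈ range (F y) := by
  obtain ⟨δ, hδ, hball⟩ := Metric.nhds_basis_closedBall.mem_iff.1 (mem_interior_iff_mem_nhds.1 hx)
  let ι : Metric.closedBall x δ → s := inclusion hball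
  have hι : Continuous ι := continuous_inclusion hball
  have hclose : ∀ᶠ y in 𝓝 y₀, ∀ a ∈ univ, dist (ι a : V) (F y (ι a)) < δ := by
    have := isCompact_iff_compactSpace.1 (isCompact_closedBall x δ)
    refine isCompact_univ.eventually_forall_of_forall_eventually fun a _ => ?_
    have hc : Continuous fun z : Y × Metric.closedBall x δ => dist (ι z.2 : V) (F z.1 (ι z.2)) := by
      have := hF.comp (f := fun z : Y × Metric.closedBall x δ => (z.1, ι z.2)) (by fun_prop)
      fun_prop
    exact hc.continuousAt.eventually (gt_mem_nhds (by simpa [hy₀] using hδ))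
  filter_upwards [hclose] with y hy
  obtain ⟨a, ha⟩ := exists_eq_of_dist_le_on_sphere hδ (f := fun a => F y (ι a))
    (hF.comp (f := fun a => (y, ι a)) (by fun_prop)) fun a _ => (hy a trivial).le
  exact ⟨ι a, ha⟩

end Brouwer

section RelativeInterior

theorem homeomorph_mem_interior_of_convex {V W : Type*} [NormedAddCommGroup V]
    [InnerProductSpace ℝ V] [FiniteDimensional ℝ V] [AddCommGroup W] [Module ℝ W]
    [TopologicalSpace W] [IsTopologicalAddGroup W] [ContinuousSMul ℝ W] {s : Set V} {t : Set W}
    (ht : Convex ℝ t) (hne : (interior t).Nonempty) (φ : s ≃ₜ t) {x : s}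
    (hx : (x : V) ∈ interior s) : (φ x : W) ∈ interior t := by
  obtain ⟨q, hq⟩ := hne
  let push : unitInterval → t → t := fun τ y => ⟨(1 - τ : ℝ) • (y : W) + (τ : ℝ) • q,
    ht y.2 (interior_subset hq) (unitInterval.one_minus_nonneg τ) τ.2.1 (by ring)⟩
  have hpush : Continuous fun z : unitInterval × t => push z.1 z.2 :=
    Continuous.subtype_mk (by fun_prop) _
  have hrange : ∀ᶠ τ in 𝓝 (0 : unitInterval),
      (x : V) ∈ range fun a => (φ.symm (push τ (φ a)) : V) :=
    eventually_mem_range_of_mem_interior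
      (F := fun τ a => (φ.symm (push τ (φ a)) : V))
      (continuous_subtype_val.comp (φ.symm.continuous.comp
        (hpush.comp (f := fun z : unitInterval × s => (z.1, φ z.2)) (by fun_prop))))
      (fun a => by simp [push]) hx
  obtain ⟨τ, ⟨a, ha⟩, hτ⟩ :=
    ((hrange.filter_mono nhdsWithin_le_nhds).and (self_mem_nhdsWithin (s := {0}ᶜ))).exists
  have hτ0 : (0 : ℝ) < τ := unitInterval.pos_iff_ne_zero.2 hτ
  rw [← φ.symm_apply_eq.1 (Subtype.ext ha)]
  exact ht.combo_self_interior_mem_interior (φ a).2 hq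
    (unitInterval.one_minus_nonneg τ) hτ0 (by ring)

section

variable {V : Type*} [NormedAddCommGroup V] [NormedSpace ℝ V] {s : Set V}

theorem exists_affineIsometry_image_eq (hs : s.Nonempty) :
    ∃ (W : Submodule ℝ V) (e : W →ᵃⁱ[ℝ] V) (s₀ : Set W), affineSpan ℝ s₀ = ⊤ ∧ e '' s₀ = s := by
  obtain ⟨p, hp⟩ := hs
  have hpspan : p ∈ affineSpan ℝ s := subset_affineSpan ℝ s hp
  have : Nonempty s := ⟨⟨p, hp⟩⟩
  let v : (affineSpan ℝ s).direction ≃ᵃⁱ[ℝ] affineSpan ℝ s :=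
    AffineIsometryEquiv.vaddConst ℝ ⟨p, hpspan⟩
  let t : Set (affineSpan ℝ s) := (↑) ⁻¹' s
  refine ⟨_, (affineSpan ℝ s).subtypeₐᵢ.comp v.toAffineIsometry, v.symm '' t, ?_, ?_⟩
  · exact v.symm.toAffineEquiv.span_eq_top_iff.1 (affineSpan_coe_preimage_eq_top s)
  · have hcomp : (affineSpan ℝ s).subtypeₐᵢ.comp v.toAffineIsometry ∘ v.symm = Subtype.val :=
      funext fun x => congrArg Subtype.val (v.apply_symm_apply x)
    rw [← image_comp, hcomp]
    exact image_preimage_eq_of_subset (by simpa using subset_affineSpan ℝ s)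

theorem intrinsicInterior_eq_interior_of_affineSpan_eq_top (hs : affineSpan ℝ s = ⊤) :
    intrinsicInterior ℝ s = interior s := by
  have hopen : IsOpen (affineSpan ℝ s : Set V) := by simp [hs]
  exact subset_antisymm (interior_maximal intrinsicInterior_subset
    (hopen.isOpenMap_subtype_val _ isOpen_interior)) interior_subset_intrinsicInterior

theorem homeomorph_mem_intrinsicInterior_of_convex {V W : Type*} [NormedAddCommGroup V]
    [InnerProductSpace ℝ V] [FiniteDimensional ℝ V] [NormedAddCommGroup W] [NormedSpace ℝ W]
    [FiniteDimensional ℝ W] {s : Set V} {t : Set W} (ht : Convex ℝ t) (φ : s ≃ₜ t) {x : s}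
    (hx : (x : V) ∈ intrinsicInterior ℝ s) : (φ x : W) ∈ intrinsicInterior ℝ t := by
  obtain ⟨V', e, s, hs, rfl⟩ := exists_affineIsometry_image_eq ⟨_, x.2⟩
  obtain ⟨W', f, t, htop, rfl⟩ := exists_affineIsometry_image_eq ⟨_, (φ x).2⟩
  have ht' : Convex ℝ t := by
    have := ht.affine_preimage f.toAffineMap
    rwa [f.coe_toAffineMap, preimage_image_eq t f.injective] at this
  let e' : s ≃ₜ e '' s := e.isometry.isEmbedding.homeomorphImage s
  let f' : t ≃ₜ f '' t := f.isometry.isEmbedding.homeomorphImage t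
  rw [e.intrinsicInterior_image, intrinsicInterior_eq_interior_of_affineSpan_eq_top hs] at hx
  rw [f.intrinsicInterior_image, intrinsicInterior_eq_interior_of_affineSpan_eq_top htop]
  obtain ⟨y, hy, hyx⟩ := hx
  let ψ : s ≃ₜ t := (e'.trans φ).trans f'.symm
  have hφ : (f (ψ ⟨y, interior_subset hy⟩) : W) = φ x := by
    have : e' ⟨y, interior_subset hy⟩ = x := Subtype.ext hyx
    calc (f (ψ ⟨y, interior_subset hy⟩) : W) = f' (f'.symm (φ (e' ⟨y, interior_subset hy⟩))) := rfl
      _ = φ x := by rw [f'.apply_symm_apply, this]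
  have hne : (interior t).Nonempty := ht'.interior_nonempty_iff_affineSpan_eq_top.2 htop
  exact ⟨_, homeomorph_mem_interior_of_convex ht' hne ψ (x := ⟨y, interior_subset hy⟩) hy, hφ⟩

theorem intrinsicInterior_closure_of_convex [FiniteDimensional ℝ V] (hs : Convex ℝ s) :
    intrinsicInterior ℝ (closure s) = intrinsicInterior ℝ s := by
  rcases s.eq_empty_or_nonempty with rfl | hne
  · rw [closure_empty]
  obtain ⟨W, e, s, htop, rfl⟩ := exists_affineIsometry_image_eq hne
  have hs' : Convex ℝ s := by
    have := hs.affine_preimage e.toAffineMap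
    rwa [e.coe_toAffineMap, preimage_image_eq s e.injective] at this
  have htop' : affineSpan ℝ (closure s) = ⊤ :=
    top_unique (htop ▸ affineSpan_mono ℝ subset_closure)
  rw [e.isometry.isClosedEmbedding.closure_image_eq, e.intrinsicInterior_image,
    e.intrinsicInterior_image, intrinsicInterior_eq_interior_of_affineSpan_eq_top htop',
    intrinsicInterior_eq_interior_of_affineSpan_eq_top htop,
    hs'.interior_closure_eq_interior_of_nonempty_interior
      (hs'.interior_nonempty_iff_affineSpan_eq_top.2 htop)]

end

theorem homeomorph_closure_mem_iff {V W : Type*} [NormedAddCommGroup V]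
    [InnerProductSpace ℝ V] [FiniteDimensional ℝ V] [NormedAddCommGroup W] [InnerProductSpace ℝ W]
    [FiniteDimensional ℝ W] {s : Set V} {t : Set W} (hs : Convex ℝ s) (ht : Convex ℝ t)
    (hso : intrinsicInterior ℝ s = s) (hto : intrinsicInterior ℝ t = t)
    (φ : closure s ≃ₜ closure t) (x : closure s) : (φ x : W) ∈ t ↔ (x : V) ∈ s := by
  have hs' : intrinsicInterior ℝ (closure s) = s :=
    (intrinsicInterior_closure_of_convex hs).trans hso
  have ht' : intrinsicInterior ℝ (closure t) = t :=
    (intrinsicInterior_closure_of_convex ht).trans hto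
  refine ⟨fun hx => hs'.le ?_, fun hx => ht'.le ?_⟩
  · simpa only [φ.symm_apply_apply] using
      homeomorph_mem_intrinsicInterior_of_convex hs.closure φ.symm (ht'.ge hx)
  · exact homeomorph_mem_intrinsicInterior_of_convex ht.closure φ (hs'.ge hx)

end RelativeInterior

section Probability

variable {ι α : Type*} [MeasurableSpace α] {μ : Measure α} {l : Filter ι}

theorem tendsto_measure_preimage_compl_of_tendstoInMeasure {β : Type*} [PseudoEMetricSpace β]
    {f : ι → α → β} {b : β} (hf : TendstoInMeasure μ f l fun _ => b) {U : Set β} (hU : U ∈ 𝓝 b) :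
    Tendsto (fun i => μ (f i ⁻¹' Uᶜ)) l (𝓝 0) := by
  obtain ⟨ε, hε, hball⟩ := Metric.nhds_basis_eball.mem_iff.1 hU
  refine tendsto_of_tendsto_of_tendsto_of_le_of_le tendsto_const_nhds (hf ε hε)
    (fun _ => zero_le) fun i => measure_mono fun ω hω => ?_
  exact not_lt.1 fun hlt => hω (hball (Metric.mem_eball.2 hlt))

theorem eventually_lt_measure_of_tendsto_measure_compl [IsProbabilityMeasure μ] {A : ι → Set α}
    (hA : Tendsto (fun i => μ (A i)ᶜ) l (𝓝 0)) {a : ℝ≥0∞} (ha : a < 1) :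
    ∀ᶠ i in l, a < μ (A i) := by
  filter_upwards [hA.eventually_lt_const (tsub_pos_of_lt ha)] with i hi
  by_contra! hle
  have hlt : μ (A i) + μ (A i)ᶜ < a + (1 - a) :=
    ENNReal.add_lt_add_of_le_of_lt (measure_ne_top μ _) hle hi
  rw [add_tsub_cancel_of_le ha.le] at hlt
  refine hlt.not_ge ?_
  calc (1 : ℝ≥0∞) = μ (A i ∪ (A i)ᶜ) := by rw [union_compl_self, measure_univ]
    _ ≤ μ (A i) + μ (A i)ᶜ := measure_union_le _ _

theorem liminf_one_div_mul_log_nonneg {p : ℕ+ → ℝ≥0∞} {a : ℝ≥0∞} (ha : a ≠ 0)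
    (hp : ∀ᶠ T in atTop, a ≤ p T) :
    0 ≤ liminf (fun T : ℕ+ => (((1 : ℝ) / (T : ℕ) : ℝ) : EReal) * ENNReal.log (p T)) atTop := by
  let b : ℝ := (ENNReal.log (min a 1)).toReal
  have hb : (b : EReal) = ENNReal.log (min a 1) :=
    EReal.coe_toReal (by simp [ENNReal.log_eq_top_iff]) (by simp [ENNReal.log_eq_bot_iff, ha])
  have hlim : Tendsto (fun T : ℕ+ => (((1 : ℝ) / (T : ℕ) : ℝ) : EReal) * (b : EReal)) atTop
      (𝓝 0) := by
    have hreal : Tendsto (fun T : ℕ+ => (1 : ℝ) / (T : ℕ) * b) atTop (𝓝 0) := by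
      simpa using ((tendsto_one_div_atTop_nhds_zero_nat (𝕜 := ℝ)).comp
        tendsto_PNat_val_atTop_atTop).mul_const b
    simpa only [EReal.coe_mul, EReal.coe_zero] using EReal.tendsto_coe.2 hreal
  rw [← hlim.liminf_eq]
  refine liminf_le_liminf (hp.mono fun T hT => ?_)
  rw [hb]
  exact mul_le_mul_of_nonneg_left (ENNReal.log_monotone ((min_le_left a 1).trans hT))
    (EReal.coe_nonneg.2 (by positivity))

end Probability

namespace DataDriven

variable {n m d : ℕ} {Ω : Type*} [MeasurableSpace Ω] {X : Set (E n)}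

section ChangeOfParameter

variable {k : ℕ} {Θ Θ' SS : Set (E d)} {Ξ : Set (E k)}

theorem denseRange_toClosure : DenseRange (toClosure : Θ → closure Θ) :=
  (denseRange_inclusion_iff subset_closure).2 subset_rfl

theorem continuous_toClosure : Continuous (toClosure : Θ → closure Θ) :=
  continuous_inclusion subset_closure

theorem isUniformInducing_toClosure : IsUniformInducing (toClosure : Θ → closure Θ) :=
  (isUniformEmbedding_set_inclusion subset_closure).isUniformInducing

/-- The homeomorphism of `Θ` onto `Ξ` induced by a homeomorphism `φ` of their closures under
which `Θ` is the preimage of `Ξ`. -/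
def restrictHomeomorph (φ : closure Θ ≃ₜ closure Ξ)
    (h : ∀ θ, (φ θ : E k) ∈ Ξ ↔ (θ : E d) ∈ Θ) : Θ ≃ₜ Ξ where
  toFun θ := ⟨φ (toClosure θ), (h _).2 θ.2⟩
  invFun θ := ⟨φ.symm (toClosure θ), (h _).1 ((φ.apply_symm_apply (toClosure θ)).symm ▸ θ.2)⟩
  left_inv θ := Subtype.ext (congrArg Subtype.val (φ.symm_apply_apply (toClosure θ)) :)
  right_inv θ := Subtype.ext (congrArg Subtype.val (φ.apply_symm_apply (toClosure θ)) :)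
  continuous_toFun := by
    have := continuous_toClosure (Θ := Θ)
    fun_prop
  continuous_invFun := by
    have := continuous_toClosure (Θ := Ξ)
    fun_prop

theorem uniformContinuous_of_toClosure_comp [CompactSpace (closure Θ)]
    {f : closure Θ → closure Ξ} (hf : Continuous f) {f₀ : Θ → Ξ}
    (hf₀ : ∀ θ, toClosure (f₀ θ) = f (toClosure θ)) : UniformContinuous f₀ := by
  rw [isUniformInducing_toClosure.uniformContinuous_iff]
  convert (CompactSpace.uniformContinuous_of_continuous hf).comp
    isUniformInducing_toClosure.uniformContinuous using 1
  exact funext hf₀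

theorem IsFinitelyParametrized.comp_surjective {Pstar : Measure Ω} {P : Θ → Measure Ω}
    (hP : IsFinitelyParametrized Pstar P) {f : Θ → Θ} (hf : f.Surjective) :
    IsFinitelyParametrized Pstar fun θ => P (f θ) where
  convex := hP.convex
  relOpen := hP.relOpen
  isProbabilityMeasure θ := hP.isProbabilityMeasure (f θ)
  mem := (hf.range_comp P).ge hP.mem

theorem IsStatistic.comp_isLocalHomeomorph {ξ : ℕ+ → Ω → E m} {P : Θ → Measure Ω}
    {S : ℕ+ → Ω → E d} {Sinf : Θ → SS} (hS : IsStatistic ξ P S SS Sinf) {f : Θ' → Θ}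
    (hf : IsLocalHomeomorph f) (hsurj : f.Surjective) :
    IsStatistic ξ (fun θ => P (f θ)) S SS (fun θ => Sinf (f θ)) where
  adapted := hS.adapted
  stateSpace := by
    simpa only [hsurj.forall (p := fun θ => ∀ T, ∀ᵐ ω ∂(P θ), S T ω ∈ _)] using hS.stateSpace
  localHomeomorph := hS.localHomeomorph.comp hf
  tendsto θ := hS.tendsto (f θ)

theorem SatisfiesLDP.comp {P : Θ → Measure Ω} {S : ℕ+ → Ω → E d} {I : SS → closure Θ → ℝ≥0∞}
    (hLDP : SatisfiesLDP P S I) {f : closure Θ' → closure Θ} {f₀ : Θ' → Θ}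
    (hf₀ : ∀ θ, toClosure (f₀ θ) = f (toClosure θ)) :
    SatisfiesLDP (fun θ => P (f₀ θ)) S fun s θ => I s (f θ) := by
  refine ⟨fun θ => hLDP.1 (f θ), fun θ D hD => ?_⟩
  simpa only [← hf₀] using hLDP.2 (f₀ θ) D hD

theorem IsRegular.comp_homeomorph {A : Set SS} {I : SS → closure Θ → ℝ≥0∞} (hI : IsRegular A I)
    (e : closure Θ' ≃ₜ closure Θ) (he : ∀ θ, (e θ : E d) ∈ Θ ↔ (θ : E d) ∈ Θ') :
    IsRegular A fun s θ => I s (e θ) where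
  rateFunction θ := hI.rateFunction (e θ)
  radialMonotonicity s hs r hr := by
    have hpre := congrArg (e ⁻¹' ·) (hI.radialMonotonicity s hs r hr)
    simpa only [e.preimage_closure, preimage_ofPred_eq, he] using hpre
  continuity := hI.continuity.comp (f := fun p : SS × closure Θ' => (p.1, e p.2))
    (by fun_prop) fun p hp => (he p.2).2 hp
  levelCompactness r :=
    ((Homeomorph.refl SS).prodCongr e).isClosedEmbedding.isCompact_preimage (hI.levelCompactness r)

theorem IsUniformlyContinuousBounded.comp_uniformContinuous {c : X → Θ → ℝ}
    (hc : IsUniformlyContinuousBounded c) {f : Ξ → Θ} (hf : UniformContinuous f) :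
    IsUniformlyContinuousBounded fun x θ => c x (f θ) :=
  ⟨hc.1.comp (uniformContinuous_id.prodMap hf), hc.2.imp fun _ h x θ => h x (f θ)⟩

end ChangeOfParameter

section RateFunction

variable {Θ SS : Set (E d)} {ξ : ℕ+ → Ω → E m} {P : Θ → Measure Ω} {S : ℕ+ → Ω → E d}
  {Sinf : Θ → SS} {I : SS → closure Θ → ℝ≥0∞} {A : Set SS}

theorem IsStatistic.tendsto_measure_compl (hS : IsStatistic ξ P S SS Sinf) {θ : Θ} {U : Set SS}
    (hU : U ∈ 𝓝 (Sinf θ)) :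
    Tendsto (fun T => P θ (S T ⁻¹' (Subtype.val '' U))ᶜ) atTop (𝓝 0) := by
  obtain ⟨V, hV, hVU⟩ := mem_nhds_subtype _ _ _ |>.1 hU
  refine tendsto_of_tendsto_of_tendsto_of_le_of_le tendsto_const_nhds
    (tendsto_measure_preimage_compl_of_tendstoInMeasure (hS.tendsto θ) hV)
    (fun _ => zero_le) fun T => measure_mono_ae ?_
  filter_upwards [hS.stateSpace.1.2 θ T] with ω hω hωU hωV
  exact hωU ⟨⟨S T ω, hω⟩, hVU hωV, rfl⟩

theorem SatisfiesLDP.iInf_eq_zero_of_mem_nhds (hLDP : SatisfiesLDP P S I)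
    (hS : IsStatistic ξ P S SS Sinf) {θ : Θ} [IsProbabilityMeasure (P θ)] {D : Set SS}
    (hD : IsClosed D) (hDθ : D ∈ 𝓝 (Sinf θ)) : ⨅ s ∈ D, I s (toClosure θ) = 0 := by
  have hpos : ∀ᶠ T in atTop, 2⁻¹ < P θ (S T ⁻¹' (Subtype.val '' D)) :=
    eventually_lt_measure_of_tendsto_measure_compl (hS.tendsto_measure_compl hDθ)
      ENNReal.one_half_lt_one
  have hle := (liminf_one_div_mul_log_nonneg (by simp) (hpos.mono fun _ => le_of_lt)).trans
    (le_trans liminf_le_limsup (hLDP.2 θ D hD.measurableSet).2)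
  rw [hD.closure_eq, EReal.le_neg, neg_zero] at hle
  exact nonpos_iff_eq_zero.1 (by exact_mod_cast hle)

theorem SatisfiesLDP.rate_eq_zero (hLDP : SatisfiesLDP P S I) (hS : IsStatistic ξ P S SS Sinf)
    (θ : Θ) [IsProbabilityMeasure (P θ)] : I (Sinf θ) (toClosure θ) = 0 := by
  by_contra hne
  obtain ⟨a, ha0, ha⟩ := exists_between (pos_iff_ne_zero.2 hne)
  obtain ⟨D, ⟨hDθ, hD⟩, hDa⟩ := (closed_nhds_basis (Sinf θ)).mem_iff.1
    (hLDP.1 (toClosure θ) (Sinf θ) a ha)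
  have hinf : a ≤ ⨅ s ∈ D, I s (toClosure θ) := le_iInf₂ fun s hs => (hDa hs).le
  rw [hLDP.iInf_eq_zero_of_mem_nhds hS hD hDθ] at hinf
  exact ha0.not_ge hinf

theorem IsRegular.compactSpace_closure (hI : IsRegular A I) (hLDP : SatisfiesLDP P S I)
    (hS : IsStatistic ξ P S SS Sinf) (hprob : ∀ θ, IsProbabilityMeasure (P θ)) :
    CompactSpace (closure Θ) := by
  have hK : IsCompact (Prod.snd '' {p : SS × closure Θ | I p.1 p.2 ≤ (0 : ℝ≥0)}) :=
    (hI.levelCompactness 0).image continuous_snd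
  have hsub : range (toClosure : Θ → closure Θ) ⊆
      Prod.snd '' {p : SS × closure Θ | I p.1 p.2 ≤ (0 : ℝ≥0)} :=
    range_subset_iff.2 fun θ => ⟨(Sinf θ, toClosure θ), (hLDP.rate_eq_zero hS θ).le, rfl⟩
  refine ⟨?_⟩
  rwa [← univ_subset_iff.1 (denseRange_toClosure.closure_eq ▸
    hK.isClosed.closure_subset_iff.2 hsub)]

theorem IsRegular.isCompact_sublevel (hI : IsRegular A I) (s : SS) (r : ℝ≥0) :
    IsCompact {θ | I s θ ≤ r} := by
  have hclosed : IsClosed {θ | I s θ ≤ r} :=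
    (hI.levelCompactness r).isClosed.preimage (Continuous.prodMk_right s)
  exact ((hI.levelCompactness r).image continuous_snd).of_isClosed_subset hclosed
    fun θ hθ => ⟨(s, θ), hθ, rfl⟩

end RateFunction

section Predictor

variable {k : ℕ} {Θ Θ' SS : Set (E d)} {Ξ : Set (E k)} {c : X → Θ → ℝ}
  {I : SS → closure Θ → ℝ≥0∞}

theorem continuous_predictorExt (hc : UniformContinuous fun p : X × Θ => c p.1 p.2) :
    Continuous fun p : X × closure Θ => predictorExt c p.1 p.2 := by
  have hi : IsUniformInducing (Prod.map id toClosure : X × Θ → X × closure Θ) :=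
    IsUniformInducing.id.prod isUniformInducing_toClosure
  exact (uniformContinuous_uniformly_extend hi (isDenseInducing_prod X Θ).dense hc).continuous

theorem predictorExt_toClosure (hc : Continuous fun p : X × Θ => c p.1 p.2) (x : X) (θ : Θ) :
    predictorExt c x (toClosure θ) = c x θ :=
  (isDenseInducing_prod X Θ).extend_eq hc (x, θ)

theorem predictorExt_comp (hc : UniformContinuous fun p : X × Θ => c p.1 p.2)
    {f : closure Ξ → closure Θ} (hf : Continuous f) {f₀ : Ξ → Θ}
    (hf₀ : ∀ θ, toClosure (f₀ θ) = f (toClosure θ)) (x : X) (θ : closure Ξ) :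
    predictorExt (fun x θ => c x (f₀ θ)) x θ = predictorExt c x (f θ) := by
  have hcont : Continuous fun p : X × closure Ξ => predictorExt c p.1 (f p.2) :=
    (continuous_predictorExt hc).comp (f := fun p : X × closure Ξ => (p.1, f p.2)) (by fun_prop)
  refine congrFun ((isDenseInducing_prod X Ξ).extend_unique (fun p => ?_) hcont) (x, θ)
  exact hf₀ p.2 ▸ predictorExt_toClosure hc.continuous p.1 (f₀ p.2)

theorem droPredictor_comp_surjective {c' : X → Θ' → ℝ} {f : closure Θ' → closure Θ}
    (hf : f.Surjective) (hc' : ∀ x θ, predictorExt c' x θ = predictorExt c x (f θ)) (r : ℝ≥0)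
    (x : X) (s : SS) :
    droPredictor c' (fun s θ => I s (f θ)) r x s = droPredictor c I r x s := by
  have hext : predictorExt c' x = predictorExt c x ∘ f := funext (hc' x)
  have himage : predictorExt c' x '' {θ | I s (f θ) ≤ r} = predictorExt c x '' {θ | I s θ ≤ r} := by
    rw [hext, image_comp]
    exact congrArg _ (image_preimage_eq {θ | I s θ ≤ r} hf)
  have hrange : range (predictorExt c' x) = range (predictorExt c x) := by
    rw [hext, hf.range_comp]
  have hexists : (∃ θ, I s (f θ) ≤ r) ↔ ∃ θ, I s θ ≤ r :=
    (hf.exists (p := fun θ => I s θ ≤ r)).symm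
  simp only [droPredictor, himage, hrange]
  classical exact if_congr hexists rfl rfl

theorem isGreatest_droPredictor (hc : UniformContinuous fun p : X × Θ => c p.1 p.2) {r : ℝ≥0}
    {x : X} {s : SS} (hcompact : IsCompact {θ | I s θ ≤ r}) (hs : ∃ θ, I s θ ≤ r) :
    IsGreatest (predictorExt c x '' {θ | I s θ ≤ r}) (droPredictor c I r x s) := by
  rw [droPredictor, if_pos hs]
  have hcont : Continuous (predictorExt c x) :=
    (continuous_predictorExt hc).comp (Continuous.prodMk_right x)
  exact (hcompact.image hcont).isGreatest_sSup (Nonempty.image _ hs)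

theorem isLUB_droPredictor [Nonempty Θ] (hc : IsUniformlyContinuousBounded c) {r : ℝ≥0} {x : X}
    {s : SS} (hs : ¬ ∃ θ, I s θ ≤ r) :
    IsLUB (range (predictorExt c x)) (droPredictor c I r x s) := by
  rw [droPredictor, if_neg hs]
  have hcont : Continuous (predictorExt c x) :=
    (continuous_predictorExt hc.1).comp (Continuous.prodMk_right x)
  obtain ⟨C, hC⟩ := hc.2
  have hbound : ∀ θ, predictorExt c x θ ≤ C := fun θ =>
    denseRange_toClosure.induction_on θ (isClosed_le hcont continuous_const) fun θ =>
      (predictorExt_toClosure hc.1.continuous x θ).trans_le (le_of_abs_le (hC x θ))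
  have : Nonempty (closure Θ) := .map toClosure ‹_›
  exact isLUB_csSup (range_nonempty _) ⟨C, forall_mem_range.2 hbound⟩

end Predictor

end DataDriven

theorem mainTheorem7_general {n m d : ℕ} {Ω : Type*} [MeasurableSpace Ω]
    (Pstar : Measure Ω)
    (X : Set (E n))
    (Θ : Set (E d)) (P : Θ → Measure Ω)
    (hP : DataDriven.IsFinitelyParametrized Pstar P)
    (c : X → Θ → ℝ) (hc : DataDriven.IsUniformlyContinuousBounded c)
    (ξ : ℕ+ → Ω → E m) (hξ : ∀ t, Measurable (ξ t))
    (S : ℕ+ → Ω → E d) (SS : Set (E d)) (Sinf : Θ → SS)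
    (hS : DataDriven.IsStatistic ξ P S SS Sinf)
    (I : SS → closure Θ → ℝ≥0∞)
    (hLDP : DataDriven.SatisfiesLDP P S I)
    (hI : DataDriven.IsRegular (range Sinf) I)
    (φ : closure Θ ≃ₜ closure Θ) :
    ∃ φ₀ : Θ ≃ₜ Θ, (∀ θ, DataDriven.toClosure (φ₀ θ) = φ (DataDriven.toClosure θ)) ∧
      DataDriven.IsFinitelyParametrized Pstar (fun θ => P (φ₀ θ)) ∧
      range (fun θ => P (φ₀ θ)) = range P ∧
      DataDriven.IsUniformlyContinuousBounded (fun x θ => c x (φ₀.symm θ)) ∧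
      (∀ x θ, DataDriven.predictorExt (fun x θ => c x (φ₀.symm θ)) x θ =
        DataDriven.predictorExt c x (φ.symm θ)) ∧
      DataDriven.IsRegular (range Sinf) (fun s θ => I s (φ.symm θ)) ∧
      DataDriven.IsFinitelyParametrized Pstar (fun θ => P (φ₀.symm θ)) ∧
      range (fun θ => Sinf (φ₀.symm θ)) = range Sinf ∧
      DataDriven.IsStatistic ξ (fun θ => P (φ₀.symm θ)) S SS (fun θ => Sinf (φ₀.symm θ)) ∧
      DataDriven.SatisfiesLDP (fun θ => P (φ₀.symm θ)) S (fun s θ => I s (φ.symm θ)) ∧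
      ∀ r : ℝ≥0,
        (∀ x s, DataDriven.droPredictor (fun x θ => c x (φ₀.symm θ))
            (fun s θ => I s (φ.symm θ)) r x s = DataDriven.droPredictor c I r x s) ∧
        (∀ x s, (∃ θ, I s θ ≤ r) →
          IsGreatest (DataDriven.predictorExt c x '' {θ | I s θ ≤ r})
            (DataDriven.droPredictor c I r x s)) ∧
        (∀ x s, (¬ ∃ θ, I s θ ≤ r) →
          IsLUB (range (DataDriven.predictorExt c x)) (DataDriven.droPredictor c I r x s)) ∧
        ∀ xt : SS → X,
          DataDriven.IsDROPrescriptor (range Sinf) (fun x θ => c x (φ₀.symm θ))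
            (fun s θ => I s (φ.symm θ)) r xt ↔
          DataDriven.IsDROPrescriptor (range Sinf) c I r xt := by
  have hmem : ∀ θ, (φ θ : E d) ∈ Θ ↔ (θ : E d) ∈ Θ :=
    homeomorph_closure_mem_iff hP.convex hP.convex hP.relOpen hP.relOpen φ
  have hmem' : ∀ θ, (φ.symm θ : E d) ∈ Θ ↔ (θ : E d) ∈ Θ :=
    homeomorph_closure_mem_iff hP.convex hP.convex hP.relOpen hP.relOpen φ.symm
  let φ₀ := DataDriven.restrictHomeomorph φ hmem
  have hφ₀ : ∀ θ, DataDriven.toClosure (φ₀.symm θ) = φ.symm (DataDriven.toClosure θ) :=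
    fun _ => rfl
  have : CompactSpace (closure Θ) := hI.compactSpace_closure hLDP hS hP.isProbabilityMeasure
  have : Nonempty Θ := ⟨hP.mem.choose⟩
  have hunif : UniformContinuous φ₀.symm :=
    DataDriven.uniformContinuous_of_toClosure_comp φ.symm.continuous hφ₀
  have hext := DataDriven.predictorExt_comp hc.1 φ.symm.continuous hφ₀
  refine ⟨φ₀, fun _ => rfl, hP.comp_surjective φ₀.surjective, φ₀.surjective.range_comp P,
    hc.comp_uniformContinuous hunif, hext, hI.comp_homeomorph φ.symm hmem',
    hP.comp_surjective φ₀.symm.surjective, φ₀.symm.surjective.range_comp Sinf,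
    hS.comp_isLocalHomeomorph φ₀.symm.isLocalHomeomorph φ₀.symm.surjective, hLDP.comp hφ₀,
    fun r => ?_⟩
  have hdro := DataDriven.droPredictor_comp_surjective (I := I) φ.symm.surjective hext r
  refine ⟨hdro, fun x s => DataDriven.isGreatest_droPredictor hc.1 (hI.isCompact_sublevel s r),
    fun x s => DataDriven.isLUB_droPredictor hc, fun xt => ?_⟩
  simp only [DataDriven.IsDROPrescriptor, hdro]

theorem mainTheorem7 {n m d : ℕ} {Ω : Type*} [MeasurableSpace Ω]
    (Pstar : Measure Ω)
    (X : Set (E n)) (hX : IsCompact X)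
    (Θ : Set (E d)) (P : Θ → Measure Ω)
    (hP : DataDriven.IsFinitelyParametrized Pstar P)
    (c : X → Θ → ℝ) (hc : DataDriven.IsUniformlyContinuousBounded c)
    (ξ : ℕ+ → Ω → E m) (hξ : ∀ t, Measurable (ξ t))
    (S : ℕ+ → Ω → E d) (SS : Set (E d)) (Sinf : Θ → SS)
    (hS : DataDriven.IsStatistic ξ P S SS Sinf)
    (I : SS → closure Θ → ℝ≥0∞)
    (hLDP : DataDriven.SatisfiesLDP P S I)
    (hI : DataDriven.IsRegular (range Sinf) I)
    (φ : closure Θ ≃ₜ closure Θ) :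
    -- `φ` restricts to a homeomorphism `φ₀` of `Θ` onto `Θ`
    ∃ φ₀ : Θ ≃ₜ Θ, (∀ θ, DataDriven.toClosure (φ₀ θ) = φ (DataDriven.toClosure θ)) ∧
      -- the transformed ambiguity set
      DataDriven.IsFinitelyParametrized Pstar (fun θ => P (φ₀ θ)) ∧
      range (fun θ => P (φ₀ θ)) = range P ∧
      -- the transformed model-based predictor and its extension
      DataDriven.IsUniformlyContinuousBounded (fun x θ => c x (φ₀.symm θ)) ∧
      (∀ x θ, DataDriven.predictorExt (fun x θ => c x (φ₀.symm θ)) x θ =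
        DataDriven.predictorExt c x (φ.symm θ)) ∧
      -- the transformed rate function
      DataDriven.IsRegular (range Sinf) (fun s θ => I s (φ.symm θ)) ∧
      -- the family in the new coordinates, its statistic and its large deviation principle
      DataDriven.IsFinitelyParametrized Pstar (fun θ => P (φ₀.symm θ)) ∧
      range (fun θ => Sinf (φ₀.symm θ)) = range Sinf ∧
      DataDriven.IsStatistic ξ (fun θ => P (φ₀.symm θ)) S SS (fun θ => Sinf (φ₀.symm θ)) ∧
      DataDriven.SatisfiesLDP (fun θ => P (φ₀.symm θ)) S (fun s θ => I s (φ.symm θ)) ∧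
      -- invariance of the distributionally robust predictor and prescriptors
      ∀ r : ℝ≥0,
        (∀ x s, DataDriven.droPredictor (fun x θ => c x (φ₀.symm θ))
            (fun s θ => I s (φ.symm θ)) r x s = DataDriven.droPredictor c I r x s) ∧
        (∀ x s, (∃ θ, I s θ ≤ r) →
          IsGreatest (DataDriven.predictorExt c x '' {θ | I s θ ≤ r})
            (DataDriven.droPredictor c I r x s)) ∧
        (∀ x s, (¬ ∃ θ, I s θ ≤ r) →
          IsLUB (range (DataDriven.predictorExt c x)) (DataDriven.droPredictor c I r x s)) ∧
        ∀ xt : SS → X,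
          DataDriven.IsDROPrescriptor (range Sinf) (fun x θ => c x (φ₀.symm θ))
            (fun s θ => I s (φ.symm θ)) r xt ↔
          DataDriven.IsDROPrescriptor (range Sinf) c I r xt :=
  mainTheorem7_general Pstar X Θ P hP c hc ξ hξ S SS Sinf hS I hLDP hI φ
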